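/- There is a simple closed curve in $\mathbb{R}^3$ (that is, a continuous injective map $\gamma\colon\mathbb{S}^1\to\mathbb{R}^3$ from the unit circle) whose range $\Gamma=\gamma(\mathbb{S}^1)$ satisfies $$\tfrac12(\Gamma+\Gamma)=[0,1]^3=\mathsf{co}(\Gamma),$$ where $\Gamma+\Gamma=\{x+y : x,y\in\Gamma\}$ is the Minkowski sum, $\tfrac12 A=\{\tfrac12 x : x\in A\}$ and $\mathsf{co}(\Gamma)$ is the convex hull of $\Gamma$. In particular, $\Gamma$ does not lie in any plane, so the answer to Ushakov's question (is there a simple closed curve in $\mathbb{R}^3$ whose range $\Gamma$ does not lie in any plane and satisfies $\frac12(\Gamma+\Gamma)=\mathsf{co}(\Gamma)$?) is positive. -/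

import Mathlib

open scoped Pointwise

/-- `γ` is a simple closed curve in `X`: a continuous injective map from the unit circle to `X`. -/
def IsSimpleClosedCurve {X : Type*} [TopologicalSpace X] (γ : Circle → X) : Prop :=
  Continuous γ ∧ Function.Injective γ

/-- The closed unit cube `[0,1]³` in Euclidean space `ℝ³`. -/
def unitCube : Set (EuclideanSpace ℝ (Fin 3)) :=
  {x | ∀ i, x i ∈ Set.Icc (0 : ℝ) 1}

/-!
# A simple closed curve whose midpoints fill the cube

The sum of the Cantor set `C` with itself is `[0, 2]`, so it suffices to find a simple closed curve
in the cube that passes through every point of `C × C × C`. We build an arc between opposite corners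
of the cube with this property: its coordinates are `x`, `x ∘ T` and `x ∘ T ∘ T`, where `T` is a
zigzag map of the unit interval and `x` solves the functional equation of `IsCantorCoordinate`.
Four reflected copies of this arc are then joined into a closed curve.
-/

open Set

/-! ### Sums and reflections of points of the Cantor set -/

/-! If a curve `Γ` in the cube contains `C × C × C`, then `C + C = [0, 2]` gives `cube ⊆ ½(Γ + Γ) ⊆
co Γ ⊆ cube`, so equality holds throughout.

The arc `A = (x, x ∘ T, x ∘ T²)` is self-similar: over each outer third of time it is an affine copy
of itself, with coordinates permuted cyclically and one of them contracted by 3. The middle third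
crosses between the copies with first coordinate equal to time. Iterating the copies reaches all of
`C³` (`exists_arc_eq`). Conversely, equal coordinates at two times persist under `T`, which expands
the distance of the times, so the times agree (`arc_injective`).

Since `C = 1/2 ± (1/6 + C/3)`, reflecting a shrunken arc in the planes where the first or second
coordinate is `1/2` covers `C³` by four copies. Tails ending on those planes join the copies into a
closed curve without new intersections. -/

theorem exists_of_mem_cantorSet {a : ℝ} (ha : a ∈ cantorSet) :
    ∃ b ∈ cantorSet, a = b / 3 ∨ a = (2 + b) / 3 := by
  rw [cantorSet_eq_union_halves] at ha
  grind

theorem div_three_mem_cantorSet {a : ℝ} (ha : a ∈ cantorSet) : a / 3 ∈ cantorSet := by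
  rw [cantorSet_eq_union_halves]
  exact Or.inl ⟨a, ha, rfl⟩

theorem two_add_div_three_mem_cantorSet {a : ℝ} (ha : a ∈ cantorSet) :
    (2 + a) / 3 ∈ cantorSet := by
  rw [cantorSet_eq_union_halves]
  exact Or.inr ⟨a, ha, rfl⟩

theorem one_sub_mem_cantorSet {a : ℝ} (ha : a ∈ cantorSet) : 1 - a ∈ cantorSet := by
  rw [cantorSet, mem_iInter] at ha ⊢
  intro n
  replace ha := ha n
  induction n generalizing a with
  | zero => simp only [preCantorSet_zero, mem_Icc] at ha ⊢; constructor <;> linarith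
  | succ n ih =>
    rcases ha with ⟨b, hb, rfl⟩ | ⟨b, hb, rfl⟩
    · exact Or.inr ⟨1 - b, ih hb, by ring⟩
    · exact Or.inl ⟨1 - b, ih hb, by ring⟩

theorem one_mem_cantorSet : (1 : ℝ) ∈ cantorSet := by
  simpa using one_sub_mem_cantorSet zero_mem_cantorSet

theorem eq_zero_of_forall_abs_le_pow {d K : ℝ} (h : ∀ n : ℕ, |d| ≤ K * (1 / 3) ^ n) : d = 0 := by
  have hlim : Filter.Tendsto (fun n : ℕ => K * (1 / 3 : ℝ) ^ n) Filter.atTop (nhds (K * 0)) :=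
    (tendsto_pow_atTop_nhds_zero_of_lt_one (by norm_num) (by norm_num)).const_mul K
  have h0 := ge_of_tendsto' hlim h
  rw [mul_zero] at h0
  exact abs_nonpos_iff.1 h0

/-- A ternary digit 0, 1 or 2 of `u` is half the sum of two Cantor digits: 0 + 0, 0 + 2 or 2 + 2.
Each digit treated divides the error by 3. -/
theorem exists_cantorSet_add_approx (n : ℕ) : ∀ u ∈ Icc (0 : ℝ) 1,
    ∃ a ∈ cantorSet, ∃ b ∈ cantorSet, |a + b - 2 * u| ≤ 2 * (1 / 3) ^ n := by
  induction n with
  | zero =>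
    rintro u ⟨h0, h1⟩
    refine ⟨0, zero_mem_cantorSet, 0, zero_mem_cantorSet, ?_⟩
    rw [abs_le]
    constructor <;> linarith
  | succ n ih =>
    rintro u ⟨h0, h1⟩
    rcases le_total u (1 / 3) with h | h
    · obtain ⟨a, ha, b, hb, hab⟩ := ih (3 * u) ⟨by linarith, by linarith⟩
      refine ⟨_, div_three_mem_cantorSet ha, _, div_three_mem_cantorSet hb, ?_⟩
      rw [abs_le, pow_succ] at *
      constructor <;> linarith
    · rcases le_total u (2 / 3) with h' | h'
      · obtain ⟨a, ha, b, hb, hab⟩ := ih (3 * u - 1) ⟨by linarith, by linarith⟩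
        refine ⟨_, div_three_mem_cantorSet ha, _, two_add_div_three_mem_cantorSet hb, ?_⟩
        rw [abs_le, pow_succ] at *
        constructor <;> linarith
      · obtain ⟨a, ha, b, hb, hab⟩ := ih (3 * u - 2) ⟨by linarith, by linarith⟩
        refine ⟨_, two_add_div_three_mem_cantorSet ha, _, two_add_div_three_mem_cantorSet hb, ?_⟩
        rw [abs_le, pow_succ] at *
        constructor <;> linarith

theorem exists_cantorSet_add_eq {u : ℝ} (hu : u ∈ Icc (0 : ℝ) 1) :
    ∃ a ∈ cantorSet, ∃ b ∈ cantorSet, a + b = 2 * u := by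
  -- By compactness the error attains its minimum, which the approximations force to be 0.
  obtain ⟨⟨a, b⟩, ⟨ha, hb⟩, hmin⟩ := (isCompact_cantorSet.prod isCompact_cantorSet).exists_isMinOn
    ⟨(0, 0), zero_mem_cantorSet, zero_mem_cantorSet⟩
    (f := fun p : ℝ × ℝ => |p.1 + p.2 - 2 * u|) (by fun_prop)
  refine ⟨a, ha, b, hb, sub_eq_zero.1 (eq_zero_of_forall_abs_le_pow (K := 2) fun n => ?_)⟩
  obtain ⟨a', ha', b', hb', h⟩ := exists_cantorSet_add_approx n u hu
  exact (isMinOn_iff.1 hmin (a', b') ⟨ha', hb'⟩).trans h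

/-! ### The zigzag map -/

/-- The zigzag map of the unit interval: it maps each of the three thirds affinely onto the unit
interval, reversing the middle one. -/
noncomputable def zigzag (t : ℝ) : ℝ :=
  min (3 * t) |3 * t - 2|

@[fun_prop]
theorem continuous_zigzag : Continuous zigzag := by
  unfold zigzag
  fun_prop

theorem zigzag_of_le {t : ℝ} (h : t ≤ 1 / 3) : zigzag t = 3 * t := by
  rw [zigzag, min_eq_left]
  rw [abs_of_nonpos] <;> linarith

theorem zigzag_of_ge {t : ℝ} (h : 2 / 3 ≤ t) : zigzag t = 3 * t - 2 := by
  rw [zigzag, abs_of_nonneg, min_eq_right] <;> linarith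

theorem zigzag_mem {t : ℝ} (h : t ∈ Icc (0 : ℝ) 1) : zigzag t ∈ Icc (0 : ℝ) 1 := by
  obtain ⟨h0, h1⟩ := h
  refine ⟨le_min (by linarith) (abs_nonneg _), ?_⟩
  rcases le_total t (1 / 3) with h | h
  · rw [zigzag_of_le h]; linarith
  · refine (min_le_right _ _).trans ?_
    rw [abs_le]
    constructor <;> linarith

theorem zigzag_zero : zigzag 0 = 0 := by
  rw [zigzag_of_le] <;> norm_num

theorem zigzag_one : zigzag 1 = 1 := by
  rw [zigzag_of_ge] <;> norm_num

theorem zigzag_third : zigzag (1 / 3) = 1 := by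
  rw [zigzag_of_le] <;> norm_num

theorem zigzag_two_thirds : zigzag (2 / 3) = 0 := by
  rw [zigzag_of_ge] <;> norm_num

/-! ### The coordinate function -/

/-- The functional equation of the coordinates of the arc. -/
structure IsCantorCoordinate (x : ℝ → ℝ) : Prop where
  continuous : Continuous x
  left : ∀ t ∈ Icc (0 : ℝ) (1 / 3), x t = x (zigzag (zigzag (zigzag t))) / 3
  middle : ∀ t ∈ Icc (1 / 3 : ℝ) (2 / 3), x t = t
  right : ∀ t ∈ Icc (2 / 3 : ℝ) 1, x t = (2 + x (zigzag (zigzag (zigzag t)))) / 3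
  mem : ∀ t ∈ Icc (0 : ℝ) 1, x t ∈ Icc (0 : ℝ) 1

/-- Each use of the equations divides the possible excess of a bounded solution over `[0, 1]` by 3.
-/
theorem mem_Icc_of_cantorCoordinate_equations {x : ℝ → ℝ} {K : ℝ} (hK : ∀ t, |x t| ≤ K)
    (left : ∀ t ∈ Icc (0 : ℝ) (1 / 3), x t = x (zigzag (zigzag (zigzag t))) / 3)
    (middle : ∀ t ∈ Icc (1 / 3 : ℝ) (2 / 3), x t = t)
    (right : ∀ t ∈ Icc (2 / 3 : ℝ) 1, x t = (2 + x (zigzag (zigzag (zigzag t)))) / 3)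
    {t : ℝ} (ht : t ∈ Icc (0 : ℝ) 1) : x t ∈ Icc (0 : ℝ) 1 := by
  have hK0 : 0 ≤ K := (abs_nonneg _).trans (hK 0)
  have key : ∀ n : ℕ, ∀ t ∈ Icc (0 : ℝ) 1,
      -(K * (1 / 3) ^ n) ≤ x t ∧ x t ≤ 1 + K * (1 / 3) ^ n := by
    intro n
    induction n with
    | zero =>
      intro t _
      have := abs_le.1 (hK t)
      constructor <;> linarith
    | succ n ih =>
      intro t ht
      have hz := ih _ (zigzag_mem (zigzag_mem (zigzag_mem ht)))
      have hp : 0 ≤ K * (1 / 3 : ℝ) ^ n := by positivity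
      rw [pow_succ]
      rcases le_total t (1 / 3) with h | h
      · rw [left t ⟨ht.1, h⟩]
        constructor <;> linarith
      · rcases le_total t (2 / 3) with h' | h'
        · rw [middle t ⟨h, h'⟩]
          constructor <;> linarith
        · rw [right t ⟨h', ht.2⟩]
          constructor <;> linarith
  have hlim : Filter.Tendsto (fun n : ℕ => K * (1 / 3 : ℝ) ^ n) Filter.atTop (nhds (K * 0)) :=
    (tendsto_pow_atTop_nhds_zero_of_lt_one (by norm_num) (by norm_num)).const_mul K
  rw [mul_zero] at hlim
  constructor
  · simpa using le_of_tendsto' hlim.neg fun n => (key n t ht).1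
  · simpa using ge_of_tendsto' (hlim.const_add 1) fun n => (key n t ht).2

theorem exists_isCantorCoordinate : ∃ x : ℝ → ℝ, IsCantorCoordinate x := by
  -- Clamping merges the three equations into one: outside its own third, `l` or `r` is frozen at
  -- the value 1 or 0 taken at the inner end of that third. The fixed point satisfies `x 0 = 0` and
  -- `x 1 = 1`, so the pieces match.
  let p : BoundedContinuousFunction ℝ ℝ := .mkOfBound
    ⟨fun t => max 0 (min (1 / 3) (t - 1 / 3)), by fun_prop⟩ 1 fun s t => by
      simp only [ContinuousMap.coe_mk, Real.dist_eq]
      grind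
  let l : C(ℝ, ℝ) := ⟨fun t => zigzag (zigzag (zigzag (max 0 (min (1 / 3) t)))), by fun_prop⟩
  let r : C(ℝ, ℝ) := ⟨fun t => zigzag (zigzag (zigzag (min 1 (max (2 / 3) t)))), by fun_prop⟩
  let Φ : BoundedContinuousFunction ℝ ℝ → BoundedContinuousFunction ℝ ℝ := fun x =>
    p + (1 / 3 : ℝ) • (x.compContinuous l + x.compContinuous r)
  have hΦ : ContractingWith (2 / 3) Φ := by
    refine ⟨by rw [← NNReal.coe_lt_coe]; norm_num, LipschitzWith.of_dist_le_mul fun x y => ?_⟩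
    rw [BoundedContinuousFunction.dist_le (by positivity)]
    intro t
    have h₁ := BoundedContinuousFunction.dist_coe_le_dist (f := x) (g := y) (l t)
    have h₂ := BoundedContinuousFunction.dist_coe_le_dist (f := x) (g := y) (r t)
    simp only [Φ, BoundedContinuousFunction.coe_add, BoundedContinuousFunction.coe_smul,
      Pi.add_apply, BoundedContinuousFunction.compContinuous_apply, smul_eq_mul, Real.dist_eq,
      NNReal.coe_div, NNReal.coe_ofNat] at h₁ h₂ ⊢
    rw [abs_le] at *
    constructor <;> linarith
  let x := hΦ.fixedPoint Φ
  have hx (t : ℝ) : x t = max 0 (min (1 / 3) (t - 1 / 3)) + 1 / 3 * (x (l t) + x (r t)) :=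
    (DFunLike.congr_fun hΦ.fixedPoint_isFixedPt t).symm
  have hl₁ {t : ℝ} (h₀ : 0 ≤ t) (h : t ≤ 1 / 3) : l t = zigzag (zigzag (zigzag t)) := by
    simp only [l, ContinuousMap.coe_mk, min_eq_right h, max_eq_right h₀]
  have hl₂ {t : ℝ} (h : 1 / 3 ≤ t) : l t = 1 := by
    simp only [l, ContinuousMap.coe_mk, min_eq_left h]
    rw [max_eq_right (by norm_num), zigzag_third, zigzag_one, zigzag_one]
  have hr₁ {t : ℝ} (h₀ : t ≤ 1) (h : 2 / 3 ≤ t) : r t = zigzag (zigzag (zigzag t)) := by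
    simp only [r, ContinuousMap.coe_mk, max_eq_right h, min_eq_right h₀]
  have hr₂ {t : ℝ} (h : t ≤ 2 / 3) : r t = 0 := by
    simp only [r, ContinuousMap.coe_mk, max_eq_left h]
    rw [min_eq_right (by norm_num), zigzag_two_thirds, zigzag_zero, zigzag_zero]
  have hx₀ : x 0 = 0 := by
    have := hx 0
    rw [hl₁ le_rfl (by norm_num), hr₂ (by norm_num)] at this
    simp only [zigzag_zero] at this
    norm_num at this
    linarith
  have hx₁ : x 1 = 1 := by
    have := hx 1
    rw [hl₂ (by norm_num), hr₁ le_rfl (by norm_num)] at this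
    simp only [zigzag_one] at this
    norm_num at this
    linarith
  have left : ∀ t ∈ Icc (0 : ℝ) (1 / 3), x t = x (zigzag (zigzag (zigzag t))) / 3 := by
    rintro t ⟨h₀, h₁⟩
    rw [hx t, hl₁ h₀ h₁, hr₂ (by linarith), hx₀, max_eq_left (min_le_of_right_le (by linarith))]
    ring
  have middle : ∀ t ∈ Icc (1 / 3 : ℝ) (2 / 3), x t = t := by
    rintro t ⟨h₀, h₁⟩
    rw [hx t, hl₂ h₀, hr₂ h₁, hx₀, hx₁, min_eq_right (by linarith), max_eq_right (by linarith)]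
    ring
  have right : ∀ t ∈ Icc (2 / 3 : ℝ) 1, x t = (2 + x (zigzag (zigzag (zigzag t)))) / 3 := by
    rintro t ⟨h₀, h₁⟩
    rw [hx t, hl₂ (by linarith), hr₁ h₁ h₀, hx₁, min_eq_left (by linarith),
      max_eq_right (by norm_num)]
    ring
  exact ⟨x, x.continuous, left, middle, right, fun t ht =>
    mem_Icc_of_cantorCoordinate_equations (fun t => x.norm_coe_le_norm t) left middle right ht⟩

namespace IsCantorCoordinate

variable {x : ℝ → ℝ}

theorem map_zero (hx : IsCantorCoordinate x) : x 0 = 0 := by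
  have := hx.left 0 ⟨le_rfl, by norm_num⟩
  simp only [zigzag_zero] at this
  linarith

theorem map_one (hx : IsCantorCoordinate x) : x 1 = 1 := by
  have := hx.right 1 ⟨by norm_num, le_rfl⟩
  simp only [zigzag_one] at this
  linarith

/-- The value `x r` lies in the same third as `r`, so equal values put `s` and `t` in a common
third. In the middle one `x` is the identity; on an outer one `T` has slope 3 and the functional
equation cancels. -/
theorem eq_or_zigzag (hx : IsCantorCoordinate x) {s t : ℝ} (hs : s ∈ Icc (0 : ℝ) 1)
    (ht : t ∈ Icc (0 : ℝ) 1) (h : x s = x t) :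
    s = t ∨ (|zigzag s - zigzag t| = 3 * |s - t| ∧
      x (zigzag (zigzag (zigzag s))) = x (zigzag (zigzag (zigzag t)))) := by
  have trichotomy : ∀ r ∈ Icc (0 : ℝ) 1, (r ≤ 1 / 3 ∧ x r ≤ 1 / 3) ∨
      (r ∈ Ioo (1 / 3 : ℝ) (2 / 3) ∧ x r = r) ∨ (2 / 3 ≤ r ∧ 2 / 3 ≤ x r) := by
    intro r hr
    have hz := hx.mem _ (zigzag_mem (zigzag_mem (zigzag_mem hr)))
    rcases le_or_gt r (1 / 3) with h | h
    · refine Or.inl ⟨h, ?_⟩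
      rw [hx.left r ⟨hr.1, h⟩]
      linarith [hz.2]
    · rcases lt_or_ge r (2 / 3) with h' | h'
      · exact Or.inr (Or.inl ⟨⟨h, h'⟩, hx.middle r ⟨h.le, h'.le⟩⟩)
      · refine Or.inr (Or.inr ⟨h', ?_⟩)
        rw [hx.right r ⟨h', hr.2⟩]
        linarith [hz.1]
  rcases trichotomy s hs with ⟨hs', hxs⟩ | ⟨⟨hs₁, hs₂⟩, hxs⟩ | ⟨hs', hxs⟩ <;>
  rcases trichotomy t ht with ⟨ht', hxt⟩ | ⟨⟨ht₁, ht₂⟩, hxt⟩ | ⟨ht', hxt⟩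
  any_goals (exfalso; linarith)
  · right
    rw [hx.left s ⟨hs.1, hs'⟩, hx.left t ⟨ht.1, ht'⟩] at h
    refine ⟨?_, by linarith⟩
    rw [zigzag_of_le hs', zigzag_of_le ht', ← mul_sub, abs_mul, abs_of_pos three_pos]
  · left
    linarith
  · right
    rw [hx.right s ⟨hs', hs.2⟩, hx.right t ⟨ht', ht.2⟩] at h
    refine ⟨?_, by linarith⟩
    rw [zigzag_of_ge hs', zigzag_of_ge ht', sub_sub_sub_cancel_right, ← mul_sub, abs_mul,
      abs_of_pos three_pos]

/-- The arc `t ↦ (x t, x (zigzag t), x (zigzag (zigzag t)))` is injective. -/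
theorem arc_injective (hx : IsCantorCoordinate x) {s t : ℝ} (hs : s ∈ Icc (0 : ℝ) 1)
    (ht : t ∈ Icc (0 : ℝ) 1) (h₁ : x s = x t) (h₂ : x (zigzag s) = x (zigzag t))
    (h₃ : x (zigzag (zigzag s)) = x (zigzag (zigzag t))) : s = t := by
  have key : ∀ n : ℕ, ∀ s ∈ Icc (0 : ℝ) 1, ∀ t ∈ Icc (0 : ℝ) 1, x s = x t →
      x (zigzag s) = x (zigzag t) → x (zigzag (zigzag s)) = x (zigzag (zigzag t)) →
      |s - t| ≤ 1 * (1 / 3) ^ n := by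
    intro n
    induction n with
    | zero =>
      rintro s ⟨hs₀, hs₁⟩ t ⟨ht₀, ht₁⟩ _ _ _
      rw [abs_le]
      constructor <;> linarith
    | succ n ih =>
      intro s hs t ht h₁ h₂ h₃
      -- The three equalities shift by one power of `T`; the functional equation supplies the new
      -- third one.
      rcases hx.eq_or_zigzag hs ht h₁ with rfl | ⟨hd, h₄⟩
      · rw [sub_self, abs_zero]
        positivity
      · have := ih _ (zigzag_mem hs) _ (zigzag_mem ht) h₂ h₃ h₄
        rw [hd] at this
        rw [pow_succ]
        linarith
  exact sub_eq_zero.1 (eq_zero_of_forall_abs_le_pow fun n => key n s hs t ht h₁ h₂ h₃)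

/-- Reaching `(b, c, a')` at time `t` reaches `(a, b, c)` at time `t / 3` or `(2 + t) / 3`,
depending on the first digit of `a`. Only the error in `a` shrinks, so three steps are needed to
improve all coordinates. -/
theorem arc_approx_step (hx : IsCantorCoordinate x) {α β γ : ℝ}
    (h : ∀ a ∈ cantorSet, ∀ b ∈ cantorSet, ∀ c ∈ cantorSet, ∃ t ∈ Icc (0 : ℝ) 1,
      |x t - a| ≤ α ∧ |x (zigzag t) - b| ≤ β ∧ |x (zigzag (zigzag t)) - c| ≤ γ) :
    ∀ a ∈ cantorSet, ∀ b ∈ cantorSet, ∀ c ∈ cantorSet, ∃ t ∈ Icc (0 : ℝ) 1,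
      |x t - a| ≤ γ * (1 / 3) ∧ |x (zigzag t) - b| ≤ α ∧ |x (zigzag (zigzag t)) - c| ≤ β := by
  intro a ha b hb c hc
  obtain ⟨a', ha', rfl | rfl⟩ := exists_of_mem_cantorSet ha <;>
  obtain ⟨t, ⟨ht₀, ht₁⟩, h₁, h₂, h₃⟩ := h b hb c hc a' ha'
  · have hz : zigzag (t / 3) = t := by rw [zigzag_of_le (by linarith)]; ring
    refine ⟨t / 3, ⟨by linarith, by linarith⟩, ?_, by rwa [hz], by rwa [hz]⟩
    rw [hx.left _ ⟨by linarith, by linarith⟩, hz]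
    rw [abs_le] at *
    constructor <;> linarith
  · have hz : zigzag ((2 + t) / 3) = t := by rw [zigzag_of_ge (by linarith)]; ring
    refine ⟨(2 + t) / 3, ⟨by linarith, by linarith⟩, ?_, by rwa [hz], by rwa [hz]⟩
    rw [hx.right _ ⟨by linarith, by linarith⟩, hz]
    rw [abs_le] at *
    constructor <;> linarith

theorem arc_approx (hx : IsCantorCoordinate x) (n : ℕ) :
    ∀ a ∈ cantorSet, ∀ b ∈ cantorSet, ∀ c ∈ cantorSet, ∃ t ∈ Icc (0 : ℝ) 1,
      |x t - a| ≤ (1 / 3) ^ n ∧ |x (zigzag t) - b| ≤ (1 / 3) ^ n ∧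
        |x (zigzag (zigzag t)) - c| ≤ (1 / 3) ^ n := by
  induction n with
  | zero =>
    intro a ha b hb c hc
    have bound {y d : ℝ} (hy : y ∈ Icc (0 : ℝ) 1) (hd : d ∈ cantorSet) :
        |y - d| ≤ (1 / 3) ^ 0 := by
      have := cantorSet_subset_unitInterval hd
      rw [pow_zero, abs_le]
      constructor <;> linarith [hy.1, hy.2, this.1, this.2]
    have h0 : (0 : ℝ) ∈ Icc (0 : ℝ) 1 := ⟨le_rfl, zero_le_one⟩
    exact ⟨0, h0, bound (hx.mem _ h0) ha, bound (hx.mem _ (zigzag_mem h0)) hb,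
      bound (hx.mem _ (zigzag_mem (zigzag_mem h0))) hc⟩
  | succ n ih =>
    simp only [pow_succ]
    exact hx.arc_approx_step (hx.arc_approx_step (hx.arc_approx_step ih))

/-- The arc passes through every point of the product of three Cantor sets. -/
theorem exists_arc_eq (hx : IsCantorCoordinate x) {a b c : ℝ} (ha : a ∈ cantorSet)
    (hb : b ∈ cantorSet) (hc : c ∈ cantorSet) : ∃ t ∈ Icc (0 : ℝ) 1,
      x t = a ∧ x (zigzag t) = b ∧ x (zigzag (zigzag t)) = c := by
  have hcont := hx.continuous
  obtain ⟨t, ht, hmin⟩ := (isCompact_Icc (a := (0 : ℝ)) (b := 1)).exists_isMinOn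
    (nonempty_Icc.2 zero_le_one)
    (f := fun t => |x t - a| + |x (zigzag t) - b| + |x (zigzag (zigzag t)) - c|) (by fun_prop)
  have h₁ := abs_nonneg (x t - a)
  have h₂ := abs_nonneg (x (zigzag t) - b)
  have h₃ := abs_nonneg (x (zigzag (zigzag t)) - c)
  have key (n : ℕ) :
      |x t - a| + |x (zigzag t) - b| + |x (zigzag (zigzag t)) - c| ≤ 3 * (1 / 3) ^ n := by
    obtain ⟨s, hs, k₁, k₂, k₃⟩ := hx.arc_approx n a ha b hb c hc
    have := isMinOn_iff.1 hmin s hs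
    linarith
  refine ⟨t, ht, ?_, ?_, ?_⟩ <;>
  · refine sub_eq_zero.1 (eq_zero_of_forall_abs_le_pow (K := 3) fun n => ?_)
    linarith [key n]

end IsCantorCoordinate

/-! ### A quarter of the closed curve -/

/-- An arc in the box `[0, 1/2] × [0, 1/2] × [0, 1]` from the face `ξ = 0` to the face `η = 0` that
meets these faces only at its end points. -/
structure IsQuarterArc (ξ η ζ : ℝ → ℝ) : Prop where
  continuous_fst : Continuous ξ
  continuous_snd : Continuous η
  continuous_trd : Continuous ζ
  fst_mem : ∀ u ∈ Icc (0 : ℝ) 1, ξ u ∈ Icc (0 : ℝ) (1 / 2)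
  snd_mem : ∀ u ∈ Icc (0 : ℝ) 1, η u ∈ Icc (0 : ℝ) (1 / 2)
  trd_mem : ∀ u ∈ Icc (0 : ℝ) 1, ζ u ∈ Icc (0 : ℝ) 1
  fst_eq_zero : ∀ u ∈ Icc (0 : ℝ) 1, ξ u = 0 ↔ u = 0
  snd_eq_zero : ∀ u ∈ Icc (0 : ℝ) 1, η u = 0 ↔ u = 1
  injective : ∀ u ∈ Icc (0 : ℝ) 1, ∀ v ∈ Icc (0 : ℝ) 1,
    ξ u = ξ v → η u = η v → ζ u = ζ v → u = v
  exists_eq : ∀ a ∈ cantorSet, ∀ b ∈ cantorSet, ∀ c ∈ cantorSet, ∃ u ∈ Icc (0 : ℝ) 1,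
    ξ u = 1 / 6 + a / 3 ∧ η u = 1 / 6 + b / 3 ∧ ζ u = c

theorem exists_isQuarterArc : ∃ ξ η ζ : ℝ → ℝ, IsQuarterArc ξ η ζ := by
  obtain ⟨x, hx⟩ := exists_isCantorCoordinate
  have hcont := hx.continuous
  -- The arc is run during the middle third of time; straight tails before and after it lead to the
  -- faces `ξ = 0` and `η = 0`. The second coordinate is reflected so that the arc ends at `η =
  -- 1/6`, where the last tail begins.
  let τ : ℝ → ℝ := fun u => max 0 (min 1 (3 * u - 1))
  have hτ : Continuous τ := by fun_prop
  have hτ₀ {u : ℝ} (h : u ≤ 1 / 3) : τ u = 0 := max_eq_left (min_le_of_right_le (by linarith))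
  have hτ₁ {u : ℝ} (h : 2 / 3 ≤ u) : τ u = 1 := by
    simp only [τ]
    rw [min_eq_left (by linarith), max_eq_right zero_le_one]
  have hτ₂ {u : ℝ} (h : 1 / 3 ≤ u) (h' : u ≤ 2 / 3) : τ u = 3 * u - 1 := by
    simp only [τ]
    rw [min_eq_right (by linarith), max_eq_right (by linarith)]
  have hτm (u : ℝ) : τ u ∈ Icc (0 : ℝ) 1 :=
    ⟨le_max_left _ _, max_le zero_le_one (min_le_left _ _)⟩
  let ξ : ℝ → ℝ := fun u => 1 / 6 + x (τ u) / 3 - max 0 (1 - 3 * u) / 6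
  let η : ℝ → ℝ := fun u => 1 / 2 - x (zigzag (τ u)) / 3 - max 0 (3 * u - 2) / 6
  let ζ : ℝ → ℝ := fun u => x (zigzag (zigzag (τ u)))
  have hξ₀ {u : ℝ} (h : u ≤ 1 / 3) : ξ u = u / 2 := by
    simp only [ξ]
    rw [hτ₀ h, hx.map_zero, max_eq_right (by linarith)]
    ring
  have hξ₁ {u : ℝ} (h : 1 / 3 ≤ u) : ξ u = 1 / 6 + x (τ u) / 3 := by
    simp only [ξ]
    rw [max_eq_left (by linarith)]
    ring
  have hη₀ {u : ℝ} (h : 2 / 3 ≤ u) : η u = (1 - u) / 2 := by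
    simp only [η]
    rw [hτ₁ h, zigzag_one, hx.map_one, max_eq_right (by linarith)]
    ring
  have hη₁ {u : ℝ} (h : u ≤ 2 / 3) : η u = 1 / 2 - x (zigzag (τ u)) / 3 := by
    simp only [η]
    rw [max_eq_left (by linarith)]
    ring
  have hx₁ (u : ℝ) := hx.mem _ (hτm u)
  have hx₂ (u : ℝ) := hx.mem _ (zigzag_mem (hτm u))
  have fst_ge {u : ℝ} (h : 1 / 3 ≤ u) : 1 / 6 ≤ ξ u := by
    rw [hξ₁ h]
    linarith [(hx₁ u).1]
  have snd_ge {u : ℝ} (h : u ≤ 2 / 3) : 1 / 6 ≤ η u := by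
    rw [hη₁ h]
    linarith [(hx₂ u).2]
  refine ⟨ξ, η, ζ, by fun_prop, by fun_prop, by fun_prop, ?_, ?_, ?_, ?_, ?_, ?_, ?_⟩
  · rintro u ⟨hu₀, hu₁⟩
    rcases le_total u (1 / 3) with h | h
    · rw [hξ₀ h]
      constructor <;> linarith
    · refine ⟨by linarith [fst_ge h], ?_⟩
      rw [hξ₁ h]
      linarith [(hx₁ u).2]
  · rintro u ⟨hu₀, hu₁⟩
    rcases le_total (2 / 3) u with h | h
    · rw [hη₀ h]
      constructor <;> linarith
    · refine ⟨by linarith [snd_ge h], ?_⟩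
      rw [hη₁ h]
      linarith [(hx₂ u).1]
  · exact fun u _ => hx.mem _ (zigzag_mem (zigzag_mem (hτm u)))
  · intro u _
    rcases le_total u (1 / 3) with h | h
    · rw [hξ₀ h]
      constructor <;> intro <;> linarith
    · have := fst_ge h
      constructor <;> intro <;> linarith
  · intro u _
    rcases le_total (2 / 3) u with h | h
    · rw [hη₀ h]
      constructor <;> intro <;> linarith
    · have := snd_ge h
      constructor <;> intro <;> linarith
  · rintro u - v - h₁ h₂ h₃
    -- The tails are recognised by `ξ < 1/6` and `η < 1/6`, and these coordinates are strictly
    -- monotone there.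
    rcases lt_or_ge u (1 / 3) with hu | hu <;> rcases lt_or_ge v (1 / 3) with hv | hv
    · rw [hξ₀ hu.le, hξ₀ hv.le] at h₁
      linarith
    · have := fst_ge hv
      rw [hξ₀ hu.le] at h₁
      linarith
    · have := fst_ge hu
      rw [hξ₀ hv.le] at h₁
      linarith
    · rcases lt_or_ge (2 / 3) u with hu' | hu' <;> rcases lt_or_ge (2 / 3) v with hv' | hv'
      · rw [hη₀ hu'.le, hη₀ hv'.le] at h₂
        linarith
      · have := snd_ge hv'
        rw [hη₀ hu'.le] at h₂
        linarith
      · have := snd_ge hu'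
        rw [hη₀ hv'.le] at h₂
        linarith
      · rw [hξ₁ hu, hξ₁ hv] at h₁
        rw [hη₁ hu', hη₁ hv'] at h₂
        have := hx.arc_injective (hτm u) (hτm v) (by linarith) (by linarith) h₃
        rw [hτ₂ hu hu', hτ₂ hv hv'] at this
        linarith
  · intro a ha b hb c hc
    obtain ⟨t, ⟨ht₀, ht₁⟩, h₁, h₂, h₃⟩ := hx.exists_arc_eq ha (one_sub_mem_cantorSet hb) hc
    have ht : τ ((1 + t) / 3) = t := by
      rw [hτ₂ (by linarith) (by linarith)]
      ring
    refine ⟨(1 + t) / 3, ⟨by linarith, by linarith⟩, ?_, ?_, ?_⟩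
    · rw [hξ₁ (by linarith), ht, h₁]
    · rw [hη₁ (by linarith), ht, h₂]
      ring
    · simp only [ζ]
      rw [ht, h₃]

/-! ### Odd extensions -/

/-- The odd function `c ↦ sign c * f (c ^ 2)`, continuous if `f` is. -/
noncomputable def oddSquare (f : ℝ → ℝ) (c : ℝ) : ℝ :=
  f (max c 0 ^ 2) - f (max (-c) 0 ^ 2)

theorem continuous_oddSquare {f : ℝ → ℝ} (hf : Continuous f) : Continuous (oddSquare f) := by
  unfold oddSquare
  fun_prop

theorem oddSquare_of_nonneg {f : ℝ → ℝ} (hf : f 0 = 0) {c : ℝ} (hc : 0 ≤ c) :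
    oddSquare f c = f (c ^ 2) := by
  rw [oddSquare, max_eq_left hc, max_eq_right (by linarith), zero_pow two_ne_zero, hf, sub_zero]

theorem oddSquare_neg (f : ℝ → ℝ) (c : ℝ) : oddSquare f (-c) = -oddSquare f c := by
  rw [oddSquare, oddSquare, neg_neg, neg_sub]

theorem abs_oddSquare {f : ℝ → ℝ} (hf : f 0 = 0) {c : ℝ} (h : 0 ≤ f (c ^ 2)) :
    |oddSquare f c| = f (c ^ 2) := by
  rcases le_total 0 c with hc | hc
  · rw [oddSquare_of_nonneg hf hc, abs_of_nonneg h]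
  · rw [← neg_neg c, oddSquare_neg, oddSquare_of_nonneg hf (by linarith), abs_neg, neg_neg,
      neg_sq, abs_of_nonneg h]

/-- If `d = -c`, oddness makes the common value its own negative, hence 0, which forces `c = 0`. -/
theorem eq_of_oddSquare_eq {f : ℝ → ℝ} (hf : f 0 = 0) {c d : ℝ} (h : oddSquare f c = oddSquare f d)
    (hsq : c ^ 2 = d ^ 2) (hpos : 0 ≤ f (c ^ 2)) (hzero : f (c ^ 2) = 0 → c = 0) : c = d := by
  rcases sq_eq_sq_iff_eq_or_eq_neg.1 hsq with rfl | rfl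
  · rfl
  · rw [oddSquare_neg, neg_eq_iff_add_eq_zero, ← two_mul, mul_eq_zero,
      or_iff_right two_ne_zero] at h
    have habs := abs_oddSquare hf hpos
    rw [oddSquare_neg, h, neg_zero, abs_zero] at habs
    have := hzero habs.symm
    linarith

theorem oddSquare_sign_mul_sqrt {f : ℝ → ℝ} (hf : f 0 = 0) {e u : ℝ} (he : e = 1 ∨ e = -1)
    (hu : 0 ≤ u) : oddSquare f (e * √u) = e * f u := by
  have h := oddSquare_of_nonneg hf (Real.sqrt_nonneg u)
  rw [Real.sq_sqrt hu] at h
  rcases he with rfl | rfl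
  · rw [one_mul, one_mul, h]
  · rw [neg_one_mul, neg_one_mul, oddSquare_neg, h]

theorem exists_sign_of_mem_cantorSet {a : ℝ} (ha : a ∈ cantorSet) :
    ∃ e : ℝ, (e = 1 ∨ e = -1) ∧ ∃ b ∈ cantorSet, a = 1 / 2 + e * (1 / 6 + b / 3) := by
  obtain ⟨b, hb, rfl | rfl⟩ := exists_of_mem_cantorSet ha
  · exact ⟨-1, Or.inr rfl, 1 - b, one_sub_mem_cantorSet hb, by ring⟩
  · exact ⟨1, Or.inl rfl, b, hb, by ring⟩

/-! ### The closed curve -/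

theorem Circle.re_sq_add_im_sq (z : Circle) : (z : ℂ).re ^ 2 + (z : ℂ).im ^ 2 = 1 := by
  have := z.normSq_coe
  rw [Complex.normSq_apply] at this
  linarith

theorem exists_circle {c s : ℝ} (h : c ^ 2 + s ^ 2 = 1) :
    ∃ z : Circle, (z : ℂ).re = c ∧ (z : ℂ).im = s := by
  refine ⟨⟨⟨c, s⟩, mem_sphere_zero_iff_norm.2 ?_⟩, rfl, rfl⟩
  rw [← sq_eq_sq₀ (norm_nonneg _) zero_le_one, Complex.sq_norm, Complex.normSq_mk]
  linarith

theorem exists_isSimpleClosedCurve_through_cantorSet :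
    ∃ γ : Circle → EuclideanSpace ℝ (Fin 3), IsSimpleClosedCurve γ ∧ range γ ⊆ unitCube ∧
      ∀ p : EuclideanSpace ℝ (Fin 3), (∀ i, p i ∈ cantorSet) → p ∈ range γ := by
  obtain ⟨ξ, η, ζ, h⟩ := exists_isQuarterArc
  have zero_mem : (0 : ℝ) ∈ Icc (0 : ℝ) 1 := ⟨le_rfl, zero_le_one⟩
  have one_mem : (1 : ℝ) ∈ Icc (0 : ℝ) 1 := ⟨zero_le_one, le_rfl⟩
  -- Reversing time makes `η'` vanish at 0, as the odd extension requires; on the circle `1 - im² =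
  -- re²`.
  let η' : ℝ → ℝ := fun v => η (1 - v)
  have hξ₀ : ξ 0 = 0 := (h.fst_eq_zero 0 zero_mem).2 rfl
  have hη₀ : η' 0 = 0 := by
    simp only [η', sub_zero]
    exact (h.snd_eq_zero 1 one_mem).2 rfl
  have hξc := continuous_oddSquare h.continuous_fst
  have hηc : Continuous (oddSquare η') :=
    continuous_oddSquare (h.continuous_snd.comp (continuous_const.sub continuous_id))
  have hζc := h.continuous_trd
  have hre : Continuous fun z : Circle => (z : ℂ).re :=
    Complex.continuous_re.comp continuous_subtype_val
  have him : Continuous fun z : Circle => (z : ℂ).im :=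
    Complex.continuous_im.comp continuous_subtype_val
  have hmem (z : Circle) : (z : ℂ).re ^ 2 ∈ Icc (0 : ℝ) 1 :=
    ⟨sq_nonneg _, by linarith [z.re_sq_add_im_sq, sq_nonneg (z : ℂ).im]⟩
  have hη' (z : Circle) : η' ((z : ℂ).im ^ 2) = η ((z : ℂ).re ^ 2) := by
    simp only [η', ← z.re_sq_add_im_sq, add_sub_cancel_right]
  have habs₁ (z : Circle) : |oddSquare ξ (z : ℂ).re| = ξ ((z : ℂ).re ^ 2) :=
    abs_oddSquare hξ₀ (h.fst_mem _ (hmem z)).1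
  have hpos₂ (z : Circle) : 0 ≤ η' ((z : ℂ).im ^ 2) := by
    rw [hη' z]
    exact (h.snd_mem _ (hmem z)).1
  have habs₂ (z : Circle) : |oddSquare η' (z : ℂ).im| = η ((z : ℂ).re ^ 2) := by
    rw [abs_oddSquare hη₀ (hpos₂ z), hη' z]
  -- The quarter arc is run at time `re²`; the signs of `re` and `im` select one of its four
  -- reflected copies.
  refine ⟨fun z => !₂[1 / 2 + oddSquare ξ (z : ℂ).re, 1 / 2 + oddSquare η' (z : ℂ).im,
    ζ ((z : ℂ).re ^ 2)], ⟨?_, ?_⟩, ?_, ?_⟩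
  · refine (PiLp.continuous_toLp 2 _).comp (continuous_pi fun i => ?_)
    fin_cases i
    · exact continuous_const.add (hξc.comp hre)
    · exact continuous_const.add (hηc.comp him)
    · exact hζc.comp (hre.pow 2)
  · intro z w hzw
    have h₀ : oddSquare ξ (z : ℂ).re = oddSquare ξ (w : ℂ).re := by
      simpa using congrArg (fun p => p 0) hzw
    have h₁ : oddSquare η' (z : ℂ).im = oddSquare η' (w : ℂ).im := by
      simpa using congrArg (fun p => p 1) hzw
    have h₂ : ζ ((z : ℂ).re ^ 2) = ζ ((w : ℂ).re ^ 2) := by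
      simpa using congrArg (fun p => p 2) hzw
    have hsq : (z : ℂ).re ^ 2 = (w : ℂ).re ^ 2 :=
      h.injective _ (hmem z) _ (hmem w) (by rw [← habs₁, ← habs₁, h₀])
        (by rw [← habs₂, ← habs₂, h₁]) h₂
    have hsq' : (z : ℂ).im ^ 2 = (w : ℂ).im ^ 2 := by
      linarith [z.re_sq_add_im_sq, w.re_sq_add_im_sq]
    refine Circle.ext (Complex.ext ?_ ?_)
    · refine eq_of_oddSquare_eq hξ₀ h₀ hsq (h.fst_mem _ (hmem z)).1 fun hz => ?_
      exact pow_eq_zero_iff two_ne_zero |>.1 ((h.fst_eq_zero _ (hmem z)).1 hz)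
    · refine eq_of_oddSquare_eq hη₀ h₁ hsq' (hpos₂ z) fun hz => ?_
      rw [hη' z] at hz
      have := (h.snd_eq_zero _ (hmem z)).1 hz
      exact pow_eq_zero_iff two_ne_zero |>.1 (by linarith [z.re_sq_add_im_sq])
  · rintro _ ⟨z, rfl⟩ i
    have h₁ := habs₁ z ▸ (h.fst_mem _ (hmem z)).2
    have h₂ := habs₂ z ▸ (h.snd_mem _ (hmem z)).2
    rw [abs_le] at h₁ h₂
    fin_cases i
    · simp only [mem_Icc]
      exact ⟨by simp; linarith, by simp; linarith⟩
    · simp only [mem_Icc]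
      exact ⟨by simp; linarith, by simp; linarith⟩
    · simpa using h.trd_mem _ (hmem z)
  · intro p hp
    obtain ⟨e, he, a, ha, hpa⟩ := exists_sign_of_mem_cantorSet (hp 0)
    obtain ⟨e', he', b, hb, hpb⟩ := exists_sign_of_mem_cantorSet (hp 1)
    obtain ⟨u, ⟨hu₀, hu₁⟩, h₁, h₂, h₃⟩ := h.exists_eq a ha b hb _ (hp 2)
    have he₂ : e ^ 2 = 1 := by rcases he with rfl | rfl <;> norm_num
    have he₂' : e' ^ 2 = 1 := by rcases he' with rfl | rfl <;> norm_num
    have hre₂ : (e * √u) ^ 2 = u := by rw [mul_pow, he₂, Real.sq_sqrt hu₀, one_mul]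
    have him₂ : (e' * √(1 - u)) ^ 2 = 1 - u := by
      rw [mul_pow, he₂', Real.sq_sqrt (by linarith), one_mul]
    obtain ⟨z, hz₁, hz₂⟩ := exists_circle (c := e * √u) (s := e' * √(1 - u))
      (by rw [hre₂, him₂]; ring)
    refine ⟨z, ?_⟩
    ext i
    fin_cases i
    · simp [hz₁, oddSquare_sign_mul_sqrt hξ₀ he hu₀, h₁, hpa]
    · simp [hz₂, oddSquare_sign_mul_sqrt hη₀ he' (sub_nonneg.2 hu₁), η', h₂, hpb]
    · simp [hz₁, hre₂, h₃]

/-! ### Properties of the cube -/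

theorem convex_unitCube : Convex ℝ unitCube := by
  intro p hp q hq a b ha hb hab i
  simpa using convex_Icc (0 : ℝ) 1 (hp i) (hq i) ha hb hab

theorem half_smul_add_subset_convexHull (s : Set (EuclideanSpace ℝ (Fin 3))) :
    (1 / 2 : ℝ) • (s + s) ⊆ convexHull ℝ s := by
  rintro _ ⟨_, ⟨p, hp, q, hq, rfl⟩, rfl⟩
  simp only [smul_add]
  exact convex_convexHull ℝ s (subset_convexHull ℝ s hp) (subset_convexHull ℝ s hq)
    (by norm_num) (by norm_num) (by norm_num)

theorem unitCube_subset_half_smul_add {s : Set (EuclideanSpace ℝ (Fin 3))}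
    (hs : ∀ p : EuclideanSpace ℝ (Fin 3), (∀ i, p i ∈ cantorSet) → p ∈ s) :
    unitCube ⊆ (1 / 2 : ℝ) • (s + s) := by
  intro p hp
  choose a ha b hb hab using fun i => exists_cantorSet_add_eq (hp i)
  refine ⟨_, add_mem_add (hs (WithLp.toLp 2 a) ha) (hs (WithLp.toLp 2 b) hb), ?_⟩
  ext i
  have := hab i
  simp
  linarith

/-- The origin and the three unit vectors have coordinates in the Cantor set. -/
theorem not_coplanar_of_cantorSet {s : Set (EuclideanSpace ℝ (Fin 3))}
    (hs : ∀ p : EuclideanSpace ℝ (Fin 3), (∀ i, p i ∈ cantorSet) → p ∈ s) :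
    ¬ Coplanar ℝ s := by
  have hspan : vectorSpan ℝ s = ⊤ := by
    rw [eq_top_iff, ← (EuclideanSpace.basisFun (Fin 3) ℝ).toBasis.span_eq, Submodule.span_le]
    rintro _ ⟨i, rfl⟩
    have h₁ : EuclideanSpace.single i (1 : ℝ) ∈ s := hs _ fun j => by
      rw [PiLp.single_apply]
      split_ifs
      exacts [one_mem_cantorSet, zero_mem_cantorSet]
    have h₀ : (0 : EuclideanSpace ℝ (Fin 3)) ∈ s := hs _ fun j => zero_mem_cantorSet
    simpa using vsub_mem_vectorSpan ℝ h₁ h₀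
  rw [coplanar_iff_finrank_le_two, hspan, finrank_top, finrank_euclideanSpace_fin]
  norm_num

theorem theorem2 :
    ∃ γ : Circle → EuclideanSpace ℝ (Fin 3), IsSimpleClosedCurve γ ∧
      (1 / 2 : ℝ) • (Set.range γ + Set.range γ) = unitCube ∧
      unitCube = convexHull ℝ (Set.range γ) ∧
      ¬ Coplanar ℝ (Set.range γ) := by
  obtain ⟨γ, hγ, hsub, hcantor⟩ := exists_isSimpleClosedCurve_through_cantorSet
  have hull_subset : convexHull ℝ (range γ) ⊆ unitCube := convexHull_min hsub convex_unitCube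
  have sub_hull := half_smul_add_subset_convexHull (range γ)
  have cube_sub := unitCube_subset_half_smul_add hcantor
  exact ⟨γ, hγ, (sub_hull.trans hull_subset).antisymm cube_sub,
    (cube_sub.trans sub_hull).antisymm hull_subset, not_coplanar_of_cantorSet hcantor⟩
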